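/- Let $n\ge 1$ be an integer. Let $A=A(n)=(a_{ij})_{i,j\ge 1}$ be the $\{0,1\}$-matrix filled in row by row, each row from left to right, by the greedy rule: $a_{kl}=0$ if $\sum_{j<l}a_{kj}\ge n+1$, or $\sum_{i<k}a_{il}\ge n+1$, or there are $i<k$ and $j<l$ with $a_{ij}=a_{il}=a_{kj}=1$; otherwise $a_{kl}=1$. Let $p$ be the smallest integer $p\ge 1$ for which there is $c\ge 0$ with $a_{i+p,j+p}=a_{ij}$ for all $i>c$ and $j\ge 1$; for this $p$ let $pp$ be the smallest such $c$. Let $b=\max\{|j-i| : a_{ij}=1,\ i>pp\}$, and let $l_{\max}$ be the maximal length of a row of $A$ with index $i>pp$, where the length of a row is $l-k+1$ if its first one is in column $k$ and its last one in column $l$. Then: 1. Every row of $A$ contains at least one and only finitely many ones, and $p$, $pp$, $b$ and $l_{\max}$ all exist (as finite integers). 2. Let $m\ge 1$ and put $\overline p=pm$, $r=\lfloor \overline p/2\rfloor$. Suppose $r>b$ and $\overline p\ge 2\,l_{\max}$, and let $v\ge pp+\overline p$ be an integer. Let $B=(b_{ij})$ be the $\overline p\times\overline p$ matrix with $$b_{ij}=\begin{cases}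 a_{v+i,v+j} & \text{if } i-r\le j\le i+r,\\ a_{v+i,v+j-\overline p} & \text{if } j>i+r,\\ a_{v+i,v+j+\overline p} & \text{if } j<i-r,\end{cases}\qquad 1\le i,j\le\overline p.$$ Let the Edgar structure $\mathcal E(n)$ be the incidence structure whose points are the columns of $B$ and whose lines are the rows of $B$, the $i$-th column being incident with the $j$-th row if and only if $b_{ji}=1$. Then any two distinct lines of $\mathcal E(n)$ have at most one common point; that is, there are no $i\ne j$ and $k\ne l$ with $b_{ik}=b_{il}=b_{jk}=b_{jl}=1$. Hence $\mathcal E(n)$ is a symmetric configuration with parameters $\overline p_{n+1}$: it has exactly $\overline p$ points, every line contains exactly $n+1$ points, every point lies on exactly $n+1$ lines, and any two distinct lines have at most one common point. -/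

import Mathlib

namespace LexConfig

/-- The greedy `{0,1}`-matrix `A(n)`. Rows and columns are numbered from `0`: `greedyMatrix n k l` is
the entry in the `(k+1)`-st row and the `(l+1)`-st column. Cells are filled row by row, each row from
left to right. The cell `(k, l)` stays `0` if row `k` already has `n + 1` ones (to the left of the
cell), or column `l` already has `n + 1` ones (above the cell), or a `1` in the cell would complete a
rectangle of ones with an earlier row `i` and an earlier column `j`; otherwise it becomes `1`. -/
def greedyMatrix (n k l : ℕ) : ℕ :=
  if n + 1 ≤ ∑ j : Fin l, greedyMatrix n k j.val ∨
     n + 1 ≤ ∑ i : Fin k, greedyMatrix n i.val l ∨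
     ∃ i : Fin k, ∃ j : Fin l,
       greedyMatrix n i.val j.val = 1 ∧ greedyMatrix n i.val l = 1 ∧ greedyMatrix n k j.val = 1
  then 0 else 1
termination_by k + l
decreasing_by all_goals omega

/-- The columns in which row `i` of `A(n)` has a one. -/
def rowSupport (n i : ℕ) : Set ℕ := {j | greedyMatrix n i j = 1}

/-- The length of row `i` of `A(n)`: position of the last one minus position of the first one,
plus one (meaningful if the row has at least one and only finitely many ones). -/
noncomputable def rowLength (n i : ℕ) : ℕ := sSup (rowSupport n i) - sInf (rowSupport n i) + 1

/-- A shift by `p` along the diagonal preserves `A(n)` from row `c` on, where rows are numbered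
from `0` (these are the rows with number `> c` if one numbers them from `1`). -/
def IsShiftInvariantFrom (n p c : ℕ) : Prop :=
  ∀ i j : ℕ, c ≤ i → greedyMatrix n (i + p) (j + p) = greedyMatrix n i j

/-- All periods of `A(n)`. -/
def periods (n : ℕ) : Set ℕ := {p | 1 ≤ p ∧ ∃ c, IsShiftInvariantFrom n p c}

/-- The period `p(n)`, i.e. the smallest period. -/
noncomputable def period (n : ℕ) : ℕ := sInf (periods n)

/-- All preperiods of `A(n)` belonging to the period `p(n)`. -/
def preperiods (n : ℕ) : Set ℕ := {c | IsShiftInvariantFrom n (period n) c}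

/-- The preperiod `pp(n)`, i.e. the smallest preperiod belonging to `p(n)`. -/
noncomputable def preperiod (n : ℕ) : ℕ := sInf (preperiods n)

/-- The distances from the main diagonal of the ones of `A(n)` in the rows after the preperiod. -/
def diagonalDistances (n : ℕ) : Set ℕ :=
  {d | ∃ i j : ℕ, preperiod n ≤ i ∧ greedyMatrix n i j = 1 ∧ d = ((j : ℤ) - (i : ℤ)).natAbs}

/-- The breadth `b(n)`. -/
noncomputable def breadth (n : ℕ) : ℕ := sSup (diagonalDistances n)

/-- The lengths of the rows of `A(n)` after the preperiod. -/
def rowLengths (n : ℕ) : Set ℕ := {s | ∃ i : ℕ, preperiod n ≤ i ∧ s = rowLength n i}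

/-- The maximal length `l_max` of a row of `A(n)` after the preperiod. -/
noncomputable def maxRowLength (n : ℕ) : ℕ := sSup (rowLengths n)

/-- The `q × q` matrix `B` obtained from the window of `A(n)` formed by the rows and columns
`v + 1, …, v + q` (numbered from `1`), folding at distance `r = ⌊q / 2⌋` from the diagonal. -/
def foldedMatrix (n q v : ℕ) : Matrix (Fin q) (Fin q) ℕ := fun i j =>
  if i.val + q / 2 < j.val then greedyMatrix n (v + i.val) (v + j.val - q)
  else if j.val + q / 2 < i.val then greedyMatrix n (v + i.val) (v + j.val + q)
  else greedyMatrix n (v + i.val) (v + j.val)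

/-- An incidence structure with point set `P` and line set `L`. -/
structure IncidenceStructure (P L : Type*) where
  /-- The incidence relation. -/
  Inc : P → L → Prop

namespace IncidenceStructure

variable {P L : Type*}

/-- The set `(l)` of points on the line `l`. -/
def pointsOn (S : IncidenceStructure P L) (l : L) : Set P := {x | S.Inc x l}

/-- The set `[x]` of lines through the point `x`. -/
def linesThrough (S : IncidenceStructure P L) (x : P) : Set L := {l | S.Inc x l}

/-- Symmetric configurations with parameters `v_k`: there are `v` points, every line has `k` points,
every point is on `k` lines, and two distinct lines have at most one common point. -/
structure IsSymmetricConfiguration (S : IncidenceStructure P L) (v k : ℕ) : Prop where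
  card_points : ENat.card P = v
  card_pointsOn : ∀ l : L, (S.pointsOn l).encard = k
  card_linesThrough : ∀ x : P, (S.linesThrough x).encard = k
  card_inter_le_one : ∀ l l' : L, l ≠ l' → (S.pointsOn l ∩ S.pointsOn l').encard ≤ 1

end IncidenceStructure

/-- The Edgar structure: points are the columns of `B`, lines are the rows of `B`, and a column is
incident with a row if the corresponding entry is `1`. Here `B` is of size `p(n) * m`. -/
def edgarStructure (n m v : ℕ) :
    IncidenceStructure (Fin (period n * m)) (Fin (period n * m)) where
  Inc := fun column row => foldedMatrix n (period n * m) v row column = 1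

end LexConfig

namespace LexConfig

theorem greedyMatrix_eq_one_or_zero (n k l : ℕ) :
    greedyMatrix n k l = 1 ∨ greedyMatrix n k l = 0 := by
  rw [greedyMatrix]
  split_ifs <;> simp

theorem greedyMatrix_eq_one_iff (n k l : ℕ) :
    greedyMatrix n k l = 1 ↔
      (∑ j ∈ Finset.range l, greedyMatrix n k j ≤ n ∧
        ∑ i ∈ Finset.range k, greedyMatrix n i l ≤ n ∧
        ¬ ∃ i < k, ∃ j < l,
          greedyMatrix n i j = 1 ∧ greedyMatrix n i l = 1 ∧ greedyMatrix n k j = 1) := by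
  rw [greedyMatrix, Fin.sum_univ_eq_sum_range (fun j => greedyMatrix n k j),
    Fin.sum_univ_eq_sum_range (fun i => greedyMatrix n i l)]
  have h : (∃ i : Fin k, ∃ j : Fin l, greedyMatrix n i.val j.val = 1 ∧
      greedyMatrix n i.val l = 1 ∧ greedyMatrix n k j.val = 1) ↔
      ∃ i < k, ∃ j < l,
        greedyMatrix n i j = 1 ∧ greedyMatrix n i l = 1 ∧ greedyMatrix n k j = 1 := by
    constructor
    · rintro ⟨i, j, h⟩
      exact ⟨i, i.2, j, j.2, h⟩
    · rintro ⟨i, hi, j, hj, h⟩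
      exact ⟨⟨i, hi⟩, ⟨j, hj⟩, h⟩
  rw [← h]
  split_ifs with hc
  · simp only [false_iff]
    rintro ⟨h1, h2, h3⟩
    rcases hc with hc | hc | hc
    · omega
    · omega
    · exact h3 hc
  · push Not at hc
    refine ⟨fun _ => ⟨by omega, by omega, ?_⟩, fun _ => rfl⟩
    push Not
    exact hc.2.2

theorem eq_of_eq_one_iff {n i j k l : ℕ}
    (h : greedyMatrix n i j = 1 ↔ greedyMatrix n k l = 1) :
    greedyMatrix n i j = greedyMatrix n k l := by
  rcases greedyMatrix_eq_one_or_zero n i j with h1 | h1 <;>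
  rcases greedyMatrix_eq_one_or_zero n k l with h2 | h2 <;> simp_all

theorem greedyMatrix_symm (n k l : ℕ) : greedyMatrix n k l = greedyMatrix n l k := by
  induction hs : k + l using Nat.strong_induction_on generalizing k l with
  | _ s ih =>
    subst hs
    apply eq_of_eq_one_iff
    rw [greedyMatrix_eq_one_iff, greedyMatrix_eq_one_iff]
    have h1 : ∑ j ∈ Finset.range l, greedyMatrix n k j = ∑ j ∈ Finset.range l, greedyMatrix n j k :=
      Finset.sum_congr rfl fun j hj =>
        ih (k + j) (by have := Finset.mem_range.1 hj; omega) _ _ rfl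
    have h2 : ∑ i ∈ Finset.range k, greedyMatrix n i l = ∑ i ∈ Finset.range k, greedyMatrix n l i :=
      Finset.sum_congr rfl fun i hi =>
        ih (i + l) (by have := Finset.mem_range.1 hi; omega) _ _ rfl
    have h3 : (∃ i < k, ∃ j < l,
          greedyMatrix n i j = 1 ∧ greedyMatrix n i l = 1 ∧ greedyMatrix n k j = 1) ↔
        ∃ i < l, ∃ j < k,
          greedyMatrix n i j = 1 ∧ greedyMatrix n i k = 1 ∧ greedyMatrix n l j = 1 := by
      constructor
      · rintro ⟨i, hi, j, hj, h⟩
        refine ⟨j, hj, i, hi, ?_⟩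
        rw [← ih (i + j) (by omega) i j rfl, ← ih (k + j) (by omega) k j rfl,
          ← ih (i + l) (by omega) i l rfl]
        tauto
      · rintro ⟨j, hj, i, hi, h⟩
        refine ⟨i, hi, j, hj, ?_⟩
        rw [ih (i + j) (by omega) i j rfl, ih (k + j) (by omega) k j rfl,
          ih (i + l) (by omega) i l rfl]
        tauto
    rw [h1, h2, h3]
    tauto

theorem sum_row_le (n k N : ℕ) : ∑ j ∈ Finset.range N, greedyMatrix n k j ≤ n + 1 := by
  induction N with
  | zero => simp
  | succ N ih =>
    rw [Finset.sum_range_succ]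
    rcases greedyMatrix_eq_one_or_zero n k N with h | h
    · have := ((greedyMatrix_eq_one_iff n k N).1 h).1
      omega
    · omega

theorem card_filter_row (n k N : ℕ) :
    ((Finset.range N).filter fun j => greedyMatrix n k j = 1).card =
      ∑ j ∈ Finset.range N, greedyMatrix n k j := by
  rw [Finset.card_filter]
  refine Finset.sum_congr rfl fun j _ => ?_
  rcases greedyMatrix_eq_one_or_zero n k j with h | h <;> simp [h]

theorem not_rectangle {n x y c d : ℕ} (hxy : x ≠ y) (hcd : c ≠ d)
    (h1 : greedyMatrix n x c = 1) (h2 : greedyMatrix n x d = 1)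
    (h3 : greedyMatrix n y c = 1) (h4 : greedyMatrix n y d = 1) : False := by
  have key : ∀ {x y c d : ℕ}, x < y → c < d → greedyMatrix n x c = 1 → greedyMatrix n x d = 1 →
      greedyMatrix n y c = 1 → greedyMatrix n y d = 1 → False := by
    intro x y c d hxy hcd h1 h2 h3 h4
    exact ((greedyMatrix_eq_one_iff n y d).1 h4).2.2 ⟨x, hxy, c, hcd, h1, h2, h3⟩
  rcases lt_or_gt_of_ne hxy with h | h <;> rcases lt_or_gt_of_ne hcd with h' | h'
  · exact key h h' h1 h2 h3 h4
  · exact key h h' h2 h1 h4 h3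
  · exact key h h' h3 h4 h1 h2
  · exact key h h' h4 h3 h2 h1

/-- A bound for the distance of the ones of `A(n)` from the diagonal. -/
def bandwidth (n : ℕ) : ℕ := n + (n + 1) * ((n + 1) * (n + 1))

/-- The columns that already have `n + 1` ones above row `k` number at most `k`. -/
theorem card_full_columns_le (n k N : ℕ) :
    ((Finset.range N).filter fun j =>
      n + 1 ≤ ∑ i ∈ Finset.range k, greedyMatrix n i j).card ≤ k := by
  set F := (Finset.range N).filter fun j => n + 1 ≤ ∑ i ∈ Finset.range k, greedyMatrix n i j
  have h1 : F.card * (n + 1) ≤ ∑ j ∈ F, ∑ i ∈ Finset.range k, greedyMatrix n i j := by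
    rw [← smul_eq_mul]
    exact Finset.card_nsmul_le_sum _ _ _ fun j hj => (Finset.mem_filter.1 hj).2
  have h2 : ∑ j ∈ F, ∑ i ∈ Finset.range k, greedyMatrix n i j ≤
      ∑ j ∈ Finset.range N, ∑ i ∈ Finset.range k, greedyMatrix n i j :=
    Finset.sum_le_sum_of_subset (Finset.filter_subset _ _)
  have h3 : ∑ j ∈ Finset.range N, ∑ i ∈ Finset.range k, greedyMatrix n i j ≤ k * (n + 1) := by
    rw [Finset.sum_comm]
    calc _ ≤ ∑ i ∈ Finset.range k, (n + 1) := Finset.sum_le_sum fun i _ => sum_row_le n i N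
      _ = k * (n + 1) := by simp
  exact Nat.le_of_mul_le_mul_right (h1.trans (h2.trans h3)) (Nat.succ_pos n)

theorem le_add_bandwidth_of_sum_row_le {n k N : ℕ}
    (h : ∑ j ∈ Finset.range N, greedyMatrix n k j ≤ n) : N ≤ k + bandwidth n := by
  set O := (Finset.range N).filter fun j => greedyMatrix n k j = 1 with hO
  set F := (Finset.range N).filter fun j =>
      n + 1 ≤ ∑ i ∈ Finset.range k, greedyMatrix n i j with hF
  set R := O.biUnion fun j' =>
    ((Finset.range k).filter fun i => greedyMatrix n j' i = 1).biUnion fun i =>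
      (Finset.range N).filter fun j => greedyMatrix n i j = 1 with hR
  have hOc : O.card ≤ n := by rw [hO, card_filter_row]; exact h
  have hRc : R.card ≤ (n + 1) * ((n + 1) * (n + 1)) := by
    refine (Finset.card_biUnion_le_card_mul O _ ((n + 1) * (n + 1)) fun j' _ => ?_).trans
      (Nat.mul_le_mul_right _ (hOc.trans n.le_succ))
    refine (Finset.card_biUnion_le_card_mul _ _ (n + 1) fun i _ => ?_).trans
      (Nat.mul_le_mul_right _ ?_)
    · rw [card_filter_row]; exact sum_row_le n i N
    · rw [card_filter_row]; exact sum_row_le n j' k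
  have hsub : Finset.range N ⊆ O ∪ F ∪ R := by
    intro j hj
    by_cases h1 : greedyMatrix n k j = 1
    · simp only [Finset.mem_union]
      exact Or.inl (Or.inl (Finset.mem_filter.2 ⟨hj, h1⟩))
    · have hjN := Finset.mem_range.1 hj
      rw [greedyMatrix_eq_one_iff] at h1
      have h2 : ∑ j ∈ Finset.range j, greedyMatrix n k j ≤ n :=
        (Finset.sum_le_sum_of_subset (Finset.range_mono hjN.le)).trans h
      simp only [Finset.mem_union]
      by_cases h3 : n + 1 ≤ ∑ i ∈ Finset.range k, greedyMatrix n i j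
      · exact Or.inl (Or.inr (Finset.mem_filter.2 ⟨hj, h3⟩))
      · right
        obtain ⟨i, hi, j', hj', e1, e2, e3⟩ :
            ∃ i < k, ∃ j' < j, greedyMatrix n i j' = 1 ∧ greedyMatrix n i j = 1 ∧
              greedyMatrix n k j' = 1 := by
          by_contra hc
          exact h1 ⟨h2, by omega, hc⟩
        simp only [hR, Finset.mem_biUnion, Finset.mem_filter, Finset.mem_range, hO]
        exact ⟨j', ⟨by omega, e3⟩, i, ⟨hi, by rw [greedyMatrix_symm]; exact e1⟩, hjN, e2⟩
  have hFc : F.card ≤ k := card_full_columns_le n k N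
  have hc := Finset.card_le_card hsub
  rw [Finset.card_range] at hc
  have h4 := Finset.card_union_le (O ∪ F) R
  have h5 := Finset.card_union_le O F
  unfold bandwidth
  omega

theorem column_le_of_eq_one {n k l : ℕ} (h : greedyMatrix n k l = 1) : l ≤ k + bandwidth n :=
  le_add_bandwidth_of_sum_row_le ((greedyMatrix_eq_one_iff n k l).1 h).1

theorem row_le_of_eq_one {n k l : ℕ} (h : greedyMatrix n k l = 1) : k ≤ l + bandwidth n :=
  column_le_of_eq_one (by rwa [greedyMatrix_symm])

theorem eq_zero_of_column_lt {n k l : ℕ} (h : l + bandwidth n < k) : greedyMatrix n k l = 0 :=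
  (greedyMatrix_eq_one_or_zero n k l).resolve_left fun h1 => by
    have := row_le_of_eq_one h1
    omega

theorem eq_zero_of_row_lt {n k l : ℕ} (h : k + bandwidth n < l) : greedyMatrix n k l = 0 := by
  rw [greedyMatrix_symm]
  exact eq_zero_of_column_lt h

theorem rowSupport_encard (n k : ℕ) : (rowSupport n k).encard = n + 1 := by
  have h1 : rowSupport n k =
      ((Finset.range (k + bandwidth n + 1)).filter fun j => greedyMatrix n k j = 1 : Finset ℕ) := by
    ext j
    simp only [rowSupport, Set.mem_ofPred_eq, Finset.coe_filter, Finset.mem_range]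
    exact ⟨fun h => ⟨by have := column_le_of_eq_one h; omega, h⟩, fun h => h.2⟩
  have h2 : ∑ j ∈ Finset.range (k + bandwidth n + 1), greedyMatrix n k j = n + 1 := by
    refine le_antisymm (sum_row_le _ _ _) ?_
    by_contra hc
    have := le_add_bandwidth_of_sum_row_le (n := n) (k := k) (N := k + bandwidth n + 1) (by omega)
    omega
  rw [h1, Set.encard_coe_eq_coe_finsetCard, card_filter_row, h2]
  norm_num

theorem rowSupport_finite (n k : ℕ) : (rowSupport n k).Finite :=
  Set.finite_of_encard_eq_coe (k := n + 1) (by rw [rowSupport_encard]; norm_num)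

theorem rowSupport_nonempty (n k : ℕ) : (rowSupport n k).Nonempty := by
  rw [← Set.encard_ne_zero, rowSupport_encard]
  simp

/-- Row `k` of `A(n)` is determined by the `2 * bandwidth n` rows above it. -/
theorem shift_row_of_shift_rows_above {n p K : ℕ} (hK : 2 * bandwidth n ≤ K)
    (h : ∀ i, K ≤ i + 2 * bandwidth n → i < K →
      ∀ j, greedyMatrix n (i + p) (j + p) = greedyMatrix n i j) (j : ℕ) :
    greedyMatrix n (K + p) (j + p) = greedyMatrix n K j := by
  induction j using Nat.strong_induction_on with
  | _ j ih =>
    by_cases hj : j + bandwidth n < K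
    · rw [eq_zero_of_column_lt hj, eq_zero_of_column_lt (by omega)]
    apply eq_of_eq_one_iff
    rw [greedyMatrix_eq_one_iff, greedyMatrix_eq_one_iff]
    have hcol : ∀ i < K, greedyMatrix n (i + p) (j + p) = greedyMatrix n i j := by
      intro i hi
      by_cases hi' : i + bandwidth n < j
      · rw [eq_zero_of_row_lt hi', eq_zero_of_row_lt (by omega)]
      · exact h i (by omega) hi j
    have h1 : ∑ l ∈ Finset.range (j + p), greedyMatrix n (K + p) l =
        ∑ l ∈ Finset.range j, greedyMatrix n K l := by
      rw [add_comm j p, Finset.sum_range_add, Finset.sum_eq_zero, zero_add]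
      · refine Finset.sum_congr rfl fun l hl => ?_
        rw [add_comm p l]
        exact ih l (Finset.mem_range.1 hl)
      · intro l hl
        have := Finset.mem_range.1 hl
        exact eq_zero_of_column_lt (by omega)
    have h2 : ∑ i ∈ Finset.range (K + p), greedyMatrix n i (j + p) =
        ∑ i ∈ Finset.range K, greedyMatrix n i j := by
      rw [add_comm K p, Finset.sum_range_add, Finset.sum_eq_zero, zero_add]
      · refine Finset.sum_congr rfl fun i hi => ?_
        rw [add_comm p i]
        exact hcol i (Finset.mem_range.1 hi)
      · intro i hi
        have := Finset.mem_range.1 hi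
        exact eq_zero_of_row_lt (by omega)
    have h3 : (∃ i < K + p, ∃ l < j + p, greedyMatrix n i l = 1 ∧
          greedyMatrix n i (j + p) = 1 ∧ greedyMatrix n (K + p) l = 1) ↔
        ∃ i < K, ∃ l < j,
          greedyMatrix n i l = 1 ∧ greedyMatrix n i j = 1 ∧ greedyMatrix n K l = 1 := by
      constructor
      · rintro ⟨i, hi, l, hl, e1, e2, e3⟩
        have b1 := column_le_of_eq_one e2
        have b2 := row_le_of_eq_one e3
        obtain ⟨i, rfl⟩ : ∃ i', i = i' + p := ⟨i - p, by omega⟩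
        obtain ⟨l, rfl⟩ : ∃ l', l = l' + p := ⟨l - p, by omega⟩
        refine ⟨i, by omega, l, by omega, ?_, ?_, ?_⟩
        · rwa [← h i (by omega) (by omega)]
        · rwa [← hcol i (by omega)]
        · rwa [← ih l (by omega)]
      · rintro ⟨i, hi, l, hl, e1, e2, e3⟩
        have b1 := column_le_of_eq_one e2
        refine ⟨i + p, by omega, l + p, by omega, ?_, ?_, ?_⟩
        · rwa [h i (by omega) (by omega)]
        · rwa [hcol i (by omega)]
        · rwa [ih l (by omega)]
    rw [h1, h2, h3]

theorem periods_nonempty (n : ℕ) : (periods n).Nonempty := by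
  set M := bandwidth n with hM
  let code : ℕ → Fin (2 * M) → Fin (4 * M + 1) → Fin 2 := fun N s t =>
    if greedyMatrix n (N + M + s) (N + t) = 1 then 1 else 0
  obtain ⟨N, N', hne, hcode⟩ := Finite.exists_ne_map_eq_of_infinite code
  wlog hlt : N < N' generalizing N N'
  · exact this N' N hne.symm hcode.symm (by omega)
  obtain ⟨p, rfl⟩ : ∃ p, N' = N + p := ⟨N' - N, by omega⟩
  refine ⟨p, by omega, N + M, ?_⟩
  intro i j hi
  induction i using Nat.strong_induction_on generalizing j with
  | _ i ih =>
    by_cases hi' : i < N + M + 2 * M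
    · by_cases h1 : j + M < i
      · rw [eq_zero_of_column_lt h1, eq_zero_of_column_lt (by omega)]
      by_cases h2 : i + M < j
      · rw [eq_zero_of_row_lt h2, eq_zero_of_row_lt (by omega)]
      have h3 := congrFun (congrFun hcode ⟨i - (N + M), by omega⟩) ⟨j - N, by omega⟩
      simp only [code] at h3
      rw [show N + M + (i - (N + M)) = i by omega, show N + (j - N) = j by omega,
        show N + p + M + (i - (N + M)) = i + p by omega,
        show N + p + (j - N) = j + p by omega] at h3
      apply eq_of_eq_one_iff
      split_ifs at h3 <;> simp_all
    · exact shift_row_of_shift_rows_above (by omega)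
        (fun i' h1 h2 j' => ih i' h2 j' (by omega)) j

theorem period_isLeast (n : ℕ) : IsLeast (periods n) (period n) :=
  ⟨Nat.sInf_mem (periods_nonempty n), fun _ h => Nat.sInf_le h⟩

theorem preperiod_isLeast (n : ℕ) : IsLeast (preperiods n) (preperiod n) :=
  ⟨Nat.sInf_mem (period_isLeast n).1.2, fun _ h => Nat.sInf_le h⟩

theorem IsShiftInvariantFrom.mul {n p c : ℕ} (h : IsShiftInvariantFrom n p c) (m : ℕ) :
    IsShiftInvariantFrom n (p * m) c := by
  induction m with
  | zero => intro i j _; simp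
  | succ m ih =>
    intro i j hi
    rw [Nat.mul_succ, ← add_assoc, ← add_assoc, h _ _ (by omega), ih i j hi]

theorem isShiftInvariantFrom_preperiod (n m : ℕ) :
    IsShiftInvariantFrom n (period n * m) (preperiod n) :=
  IsShiftInvariantFrom.mul (preperiod_isLeast n).1 m

theorem breadth_isGreatest (n : ℕ) : IsGreatest (diagonalDistances n) (breadth n) := by
  have hb : BddAbove (diagonalDistances n) := by
    refine ⟨bandwidth n, ?_⟩
    rintro d ⟨i, j, _, h, rfl⟩
    have h1 := column_le_of_eq_one h
    have h2 := row_le_of_eq_one h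
    omega
  have hne : (diagonalDistances n).Nonempty := by
    obtain ⟨j, hj⟩ := rowSupport_nonempty n (preperiod n)
    exact ⟨_, _, j, le_rfl, hj, rfl⟩
  exact ⟨Nat.sSup_mem hne hb, fun _ h => le_csSup hb h⟩

theorem column_le_breadth {n i j : ℕ} (hi : preperiod n ≤ i) (h : greedyMatrix n i j = 1) :
    j ≤ i + breadth n ∧ i ≤ j + breadth n := by
  have := (breadth_isGreatest n).2 ⟨i, j, hi, h, rfl⟩
  omega

theorem maxRowLength_isGreatest (n : ℕ) : IsGreatest (rowLengths n) (maxRowLength n) := by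
  have hb : BddAbove (rowLengths n) := by
    refine ⟨2 * bandwidth n + 1, ?_⟩
    rintro d ⟨i, _, rfl⟩
    have h1 : sSup (rowSupport n i) ≤ i + bandwidth n :=
      csSup_le (rowSupport_nonempty n i) fun j hj => column_le_of_eq_one hj
    have h2 := row_le_of_eq_one (Nat.sInf_mem (rowSupport_nonempty n i))
    unfold rowLength
    omega
  exact ⟨Nat.sSup_mem ⟨_, _, le_rfl, rfl⟩ hb, fun _ h => le_csSup hb h⟩

theorem column_lt_add_maxRowLength {n i c d : ℕ} (hi : preperiod n ≤ i)
    (hc : greedyMatrix n i c = 1) (hd : greedyMatrix n i d = 1) : c < d + maxRowLength n := by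
  have h1 : rowLength n i ≤ maxRowLength n := (maxRowLength_isGreatest n).2 ⟨i, hi, rfl⟩
  have h2 : c ≤ sSup (rowSupport n i) := le_csSup (rowSupport_finite n i).bddAbove hc
  have h3 : sInf (rowSupport n i) ≤ d := Nat.sInf_le hd
  unfold rowLength at h1
  omega

/-- Columns far enough to the right have no ones in the rows of the preperiod. -/
theorem preperiod_le_of_eq_one {n i l : ℕ} (hl : preperiod n + breadth n ≤ l)
    (h : greedyMatrix n i l = 1) : preperiod n ≤ i := by
  set Q := period n * (bandwidth n + 1) with hQ
  have hinv : IsShiftInvariantFrom n Q (preperiod n) := isShiftInvariantFrom_preperiod n _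
  have hQM : bandwidth n + 1 ≤ Q := Nat.le_mul_of_pos_left _ (period_isLeast n).1.1
  set S := rowSupport n l ∩ Set.Ici (preperiod n) with hS
  have hsub : rowSupport n (l + Q) ⊆ (fun x => x + Q) '' S := by
    intro x hx
    have hx' : greedyMatrix n x (l + Q) = 1 := by rw [greedyMatrix_symm]; exact hx
    have h1 := column_le_of_eq_one hx'
    have h2 := column_le_breadth (by omega) hx'
    obtain ⟨y, rfl⟩ : ∃ y, x = y + Q := ⟨x - Q, by omega⟩
    rw [hinv _ _ (by omega), greedyMatrix_symm] at hx'
    exact ⟨y, ⟨hx', show preperiod n ≤ y by omega⟩, rfl⟩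
  have hle : (rowSupport n l).encard ≤ S.encard := by
    rw [rowSupport_encard, ← rowSupport_encard n (l + Q)]
    exact (Set.encard_le_encard hsub).trans (Set.encard_image_le _ _)
  have heq : S = rowSupport n l :=
    (rowSupport_finite n l).eq_of_subset_of_encard_le'
      Set.inter_subset_left hle
  have hi : i ∈ S := by
    rw [heq]
    show greedyMatrix n l i = 1
    rwa [greedyMatrix_symm]
  exact hi.2

/-- The column of `A(n)` that is folded to column `j` of `B` in row `i`. -/
def unfoldColumn (q v i j : ℕ) : ℕ :=
  if i + q / 2 < j then v + j - q else if j + q / 2 < i then v + j + q else v + j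

theorem foldedMatrix_eq (n q v : ℕ) (i j : Fin q) :
    foldedMatrix n q v i j = greedyMatrix n (v + i) (unfoldColumn q v i j) := by
  unfold foldedMatrix unfoldColumn
  split_ifs <;> rfl

theorem foldedMatrix_eq_transpose {n q v : ℕ} (hv : preperiod n + q ≤ v)
    (hinv : IsShiftInvariantFrom n q (preperiod n)) (i j : Fin q) :
    foldedMatrix n q v i j = greedyMatrix n (v + j) (unfoldColumn q v j i) := by
  have hi := i.2
  have hj := j.2
  unfold foldedMatrix unfoldColumn
  rw [greedyMatrix_symm n (v + j)]
  split_ifs with h1 h2 h3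
  · omega
  · rw [← hinv _ _ (by omega)]
    congr 1
    omega
  · rw [← hinv (v + i - q) _ (by omega)]
    congr 1
    omega
  · rfl

theorem unfoldColumn_injective {q v : ℕ} (hv : q ≤ v) (i : Fin q) :
    Function.Injective fun j : Fin q => unfoldColumn q v i j := by
  intro j k h
  have hj := j.2
  have hk := k.2
  have hi := i.2
  ext
  simp only [unfoldColumn] at h
  split_ifs at h <;> omega

/-- The ones of row `v + i` of `A(n)` are recovered by unfolding. -/
theorem encard_setOf_unfoldColumn {n q v b : ℕ} (hv : q ≤ v) (hb : b < q / 2) (i : Fin q)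
    (h : ∀ c, greedyMatrix n (v + i) c = 1 → c ≤ v + i + b ∧ v + i ≤ c + b) :
    {j : Fin q | greedyMatrix n (v + i) (unfoldColumn q v i j) = 1}.encard = n + 1 := by
  have hsub : rowSupport n (v + i) ⊆ Set.range fun j : Fin q => unfoldColumn q v i j := by
    intro c hc
    have h1 := h c hc
    have hi := i.2
    by_cases h2 : c < v
    · refine ⟨⟨c + q - v, by omega⟩, ?_⟩
      simp only [unfoldColumn]
      split_ifs <;> omega
    by_cases h3 : v + q ≤ c
    · refine ⟨⟨c - q - v, by omega⟩, ?_⟩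
      simp only [unfoldColumn]
      split_ifs <;> omega
    · refine ⟨⟨c - v, by omega⟩, ?_⟩
      simp only [unfoldColumn]
      split_ifs <;> omega
  rw [← rowSupport_encard n (v + i),
    ← Set.encard_preimage_of_injective_subset_range (unfoldColumn_injective hv i) hsub]
  rfl

theorem foldedMatrix_not_rectangle {n q v : ℕ} (hv : preperiod n + q ≤ v)
    (hinv : IsShiftInvariantFrom n q (preperiod n)) (hL : 2 * maxRowLength n ≤ q)
    {i j k l : Fin q} (hij : i ≠ j) (hkl : k ≠ l)
    (h1 : foldedMatrix n q v i k = 1) (h2 : foldedMatrix n q v i l = 1)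
    (h3 : foldedMatrix n q v j k = 1) (h4 : foldedMatrix n q v j l = 1) : False := by
  rw [foldedMatrix_eq] at h1 h2 h3 h4
  have hi := i.2
  have hj := j.2
  have hij' : i.val ≠ j.val := fun h => hij (Fin.ext h)
  have hcd : unfoldColumn q v i k ≠ unfoldColumn q v i l := fun h =>
    hkl (unfoldColumn_injective (by omega) i h)
  have hcases : ∀ a b : Fin q, unfoldColumn q v a b + q = v + b ∨
      unfoldColumn q v a b = v + b ∨ unfoldColumn q v a b = v + b + q := by
    intro a b
    unfold unfoldColumn
    split_ifs <;> omega
  have c1 := hcases i k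
  have c2 := hcases i l
  have c3 := hcases j k
  have c4 := hcases j l
  have hvi : preperiod n ≤ v + i := by omega
  have hvj : preperiod n ≤ v + j := by omega
  have l1 := column_lt_add_maxRowLength hvi h1 h2
  have l2 := column_lt_add_maxRowLength hvi h2 h1
  have l3 := column_lt_add_maxRowLength hvj h3 h4
  have l4 := column_lt_add_maxRowLength hvj h4 h3
  generalize unfoldColumn q v i k = x at *
  generalize unfoldColumn q v i l = y at *
  generalize unfoldColumn q v j k = z at *
  generalize unfoldColumn q v j l = w at *
  have key : ∃ t ≤ 2, (z = x + q * t ∧ w = y + q * t) ∨ (x = z + q * t ∧ y = w + q * t) := by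
    have hz : z = x ∨ z = x + q ∨ z = x + q * 2 ∨ x = z + q ∨ x = z + q * 2 := by
      clear c2 c4 l1 l2 l3 l4
      omega
    have hw : w = y ∨ w = y + q ∨ w = y + q * 2 ∨ y = w + q ∨ y = w + q * 2 := by
      clear c1 c3 l1 l2 l3 l4
      omega
    clear c1 c2 c3 c4
    have hsum : z + y = w + x := by
      rcases hz with h | h | h | h | h <;> rcases hw with h' | h' | h' | h' | h' <;> omega
    have : (z = x ∧ w = y) ∨ (z = x + q ∧ w = y + q) ∨ (z = x + q * 2 ∧ w = y + q * 2) ∨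
        (x = z + q ∧ y = w + q) ∨ (x = z + q * 2 ∧ y = w + q * 2) := by
      clear hw
      omega
    rcases this with h | h | h | h | h
    · exact ⟨0, by omega, Or.inl (by simpa using h)⟩
    · exact ⟨1, by omega, Or.inl (by simpa using h)⟩
    · exact ⟨2, by omega, Or.inl h⟩
    · exact ⟨1, by omega, Or.inr (by simpa using h)⟩
    · exact ⟨2, by omega, Or.inr h⟩
  obtain ⟨t, ht, ⟨rfl, rfl⟩ | ⟨rfl, rfl⟩⟩ := key
  · rw [← hinv.mul t _ _ hvi] at h1 h2
    refine not_rectangle ?_ ?_ h1 h2 h3 h4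
    · interval_cases t <;> omega
    · omega
  · rw [← hinv.mul t _ _ hvj] at h3 h4
    refine not_rectangle ?_ ?_ h1 h2 h3 h4
    · interval_cases t <;> omega
    · omega

end LexConfig

theorem theorem4p4 (n : ℕ) (hn : 1 ≤ n) :
    -- the parameters of the matrix are well defined
    (∀ i : ℕ, (LexConfig.rowSupport n i).Finite ∧ (LexConfig.rowSupport n i).Nonempty) ∧
    IsLeast (LexConfig.periods n) (LexConfig.period n) ∧
    IsLeast (LexConfig.preperiods n) (LexConfig.preperiod n) ∧
    IsGreatest (LexConfig.diagonalDistances n) (LexConfig.breadth n) ∧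
    IsGreatest (LexConfig.rowLengths n) (LexConfig.maxRowLength n) ∧
    -- the folded matrix and its Edgar structure
    ∀ m v : ℕ, 1 ≤ m →
      LexConfig.breadth n < LexConfig.period n * m / 2 →
      LexConfig.preperiod n + LexConfig.period n * m ≤ v →
      2 * LexConfig.maxRowLength n ≤ LexConfig.period n * m →
      (∀ a b : Fin (LexConfig.period n * m), a ≠ b →
        ((LexConfig.edgarStructure n m v).pointsOn a ∩
          (LexConfig.edgarStructure n m v).pointsOn b).encard ≤ 1) ∧
      (¬ ∃ i j k l : Fin (LexConfig.period n * m), i ≠ j ∧ k ≠ l ∧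
        LexConfig.foldedMatrix n (LexConfig.period n * m) v i k = 1 ∧
        LexConfig.foldedMatrix n (LexConfig.period n * m) v i l = 1 ∧
        LexConfig.foldedMatrix n (LexConfig.period n * m) v j k = 1 ∧
        LexConfig.foldedMatrix n (LexConfig.period n * m) v j l = 1) ∧
      (LexConfig.edgarStructure n m v).IsSymmetricConfiguration
        (LexConfig.period n * m) (n + 1) := by
  refine ⟨fun i => ⟨LexConfig.rowSupport_finite n i, LexConfig.rowSupport_nonempty n i⟩,
    LexConfig.period_isLeast n, LexConfig.preperiod_isLeast n, LexConfig.breadth_isGreatest n,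
    LexConfig.maxRowLength_isGreatest n, ?_⟩
  intro m v _ hb hv hL
  have hinv := LexConfig.isShiftInvariantFrom_preperiod n m
  have hqv : LexConfig.period n * m ≤ v := by omega
  have hpp : ∀ l, LexConfig.preperiod n ≤ v + l := fun l => by omega
  have hrect : ¬ ∃ i j k l : Fin (LexConfig.period n * m), i ≠ j ∧ k ≠ l ∧
        LexConfig.foldedMatrix n (LexConfig.period n * m) v i k = 1 ∧
        LexConfig.foldedMatrix n (LexConfig.period n * m) v i l = 1 ∧
        LexConfig.foldedMatrix n (LexConfig.period n * m) v j k = 1 ∧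
        LexConfig.foldedMatrix n (LexConfig.period n * m) v j l = 1 := by
    rintro ⟨i, j, k, l, hij, hkl, h1, h2, h3, h4⟩
    exact LexConfig.foldedMatrix_not_rectangle hv hinv hL hij hkl h1 h2 h3 h4
  have hinter : ∀ a b : Fin (LexConfig.period n * m), a ≠ b →
        ((LexConfig.edgarStructure n m v).pointsOn a ∩
          (LexConfig.edgarStructure n m v).pointsOn b).encard ≤ 1 := by
    intro a b hab
    rw [Set.encard_le_one_iff]
    intro k l hk hl
    by_contra hkl
    exact hrect ⟨a, b, k, l, hab, hkl, hk.1, hl.1, hk.2, hl.2⟩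
  refine ⟨hinter, hrect, by simp, fun l => ?_, fun x => ?_, hinter⟩
  · rw [Nat.cast_add_one, ← LexConfig.encard_setOf_unfoldColumn hqv hb l
      fun c hc => LexConfig.column_le_breadth (hpp l) hc]
    congr 1
    ext k
    rw [Set.mem_ofPred_eq, ← LexConfig.foldedMatrix_eq]
    rfl
  · rw [Nat.cast_add_one, ← LexConfig.encard_setOf_unfoldColumn hqv hb x fun c hc => ?_]
    · congr 1
      ext k
      rw [Set.mem_ofPred_eq, ← LexConfig.foldedMatrix_eq_transpose hv hinv]
      rfl
    · rw [LexConfig.greedyMatrix_symm] at hc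
      exact (LexConfig.column_le_breadth
        (LexConfig.preperiod_le_of_eq_one (by omega) hc) hc).symm
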